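/- Let $X$ be a Banach space with closed unit ball $X_1$. A point $x \in X_1$ is a strongly extreme point of $X_1$ if for all sequences $(y_n)$, $(z_n)$ in $X_1$, norm convergence $\frac{y_n+z_n}{2} \to x$ implies $\|y_n - z_n\| \to 0$. A linear extreme point of $X_1$ is an extreme point in the usual sense of convexity. Let $\mathcal A$ be a unital $C^*$-algebra with identity $\mathbf 1$. A point $x \in \mathcal A_1$ is a $C^*$-extreme point of $\mathcal A_1$ if, whenever $x = \sum_{i=1}^k t_i^* x_i t_i$ with $x_1,\dots,x_k \in \mathcal A_1$ and invertible $t_1,\dots,t_k \in \mathcal A$ such that $\sum_{i=1}^k t_i^* t_i = \mathbf 1$, there exist unitaries $u_1,\dots,u_k \in \mathcal A$ with $x_i = u_i^* x u_i$ for $i = 1,\dots,k$. Theorem. Let $\mathcal M \subseteq B(H)$ be a von Neumann algebra on a complex Hilbert space $H$, and let $x \in \mathcal M_1$. The following are equivalent: (i) $x$ is a $C^*$-extreme point of $\mathcal M_1$; (ii) $x$ is a linear extreme point of $\mathcal M_1$; (iii) $x$ is a strongly extreme point of $\mathcal M_1$. Moreover, for every unital $C^*$-algebra $\mathcal A$,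 every linear extreme point of the closed unit ball $\mathcal A_1$ is a strongly extreme point of $\mathcal A_1$. -/

import Mathlib

open Metric Filter Topology

/-- `x` belongs to the closed unit ball of the normed space `X` and is a strongly extreme point of
it: whenever the midpoints of two sequences in the ball converge in norm to `x`, the differences of
the two sequences converge in norm to `0`. -/
def IsStronglyExtremePoint {X : Type*} [NormedAddCommGroup X] [NormedSpace ℝ X] (x : X) : Prop :=
  x ∈ closedBall (0 : X) 1 ∧
    ∀ y z : ℕ → X, (∀ n, y n ∈ closedBall (0 : X) 1) → (∀ n, z n ∈ closedBall (0 : X) 1) →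
      Tendsto (fun n => (1 / 2 : ℝ) • (y n + z n)) atTop (𝓝 x) →
      Tendsto (fun n => y n - z n) atTop (𝓝 0)

/-- `x` is the C⋆-convex combination of `y 0, …, y (k - 1)` with coefficients `t i`. -/
def IsCStarConvexCombination {A : Type*} [CStarAlgebra A] {k : ℕ} (x : A) (y t : Fin k → A) :
    Prop :=
  ∑ i, star (t i) * t i = 1 ∧ x = ∑ i, star (t i) * y i * t i

/-- A C⋆-convex combination is proper if all its coefficients are invertible. -/
def IsProperCStarConvexCombination {A : Type*} [CStarAlgebra A] {k : ℕ} (x : A)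
    (y t : Fin k → A) : Prop :=
  IsCStarConvexCombination x y t ∧ ∀ i, IsUnit (t i)

/-- `x` belongs to the closed unit ball of the unital C⋆-algebra `A` and is a C⋆-extreme point of
it: whenever `x` is a proper C⋆-convex combination of elements of the ball, each of these elements
is unitarily equivalent to `x` in `A`. -/
def IsCStarExtremePoint {A : Type*} [CStarAlgebra A] (x : A) : Prop :=
  x ∈ closedBall (0 : A) 1 ∧
    ∀ (k : ℕ) (y t : Fin k → A), (∀ i, y i ∈ closedBall (0 : A) 1) →
      IsProperCStarConvexCombination x y t →
      ∀ i, ∃ u ∈ unitary A, y i = star u * x * u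

/-- A von Neumann algebra is closed in the norm topology, being a commutant. -/
theorem VonNeumannAlgebra.isClosed_toStarSubalgebra {H : Type*} [NormedAddCommGroup H]
    [InnerProductSpace ℂ H] [CompleteSpace H] (M : VonNeumannAlgebra H) :
    IsClosed (M.toStarSubalgebra : Set (H →L[ℂ] H)) := by
  rw [VonNeumannAlgebra.coe_toStarSubalgebra, ← M.centralizer_centralizer]
  exact Set.isClosed_centralizer _

/-- A von Neumann algebra, with the operator norm, is a unital C⋆-algebra. -/
noncomputable instance VonNeumannAlgebra.instCStarAlgebra {H : Type*} [NormedAddCommGroup H]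
    [InnerProductSpace ℂ H] [CompleteSpace H] (M : VonNeumannAlgebra H) :
    CStarAlgebra M.toStarSubalgebra :=
  haveI : IsClosed (M.toStarSubalgebra : Set (H →L[ℂ] H)) := M.isClosed_toStarSubalgebra
  StarSubalgebra.cstarAlgebra M.toStarSubalgebra

/-! Write e = 1 - x*x and f = 1 - xx*. An extreme point x of the ball of a C⋆-algebra A is a partial
isometry with fAe = 0. If w is the midpoint and d the half difference of two points of the ball,
then d*d ≤ 1 - w*w, and likewise for adjoints. As w → x, this forces d(x*x) → 0 and (xx*)d → 0;
since fde = 0, these two corners determine d, so d → 0. This is strong extremality.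

Extreme implies C⋆-extreme in M. Suppose first that x is an isometry. Positivity turns a proper
C⋆-convex combination into the relations `y i * t i = t i * x`, with every `y i` an isometry
(`mul_eq_mul_of_isometry`). Similar isometries in M are unitarily equivalent: in the picture of the
Wold decomposition, a new intertwiner keeps t on the unitary part of x and uses the adjoint of its
inverse to match the wandering spaces ker x* and ker y*. It is a strong limit of
`approxIntertwiner`, hence lies in M, is invertible, and intertwines the adjoints too, so its polar
part is the required unitary. In general fMe = 0 gives a central projection z for which x is an
isometry on the z-part and a co-isometry on the (1 - z)-part; the two unitaries obtained are glued
along z.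

C⋆-extreme implies extreme. Weak operator compactness of the ball gives x = v|x| with v extreme.
Since |x| is the mean of a unitary w and its adjoint, x is the mean of the extreme points vw and
vw*. C⋆-extremality makes x unitarily equivalent to vw, hence extreme. -/

/-! ### Extreme points of the ball through symmetric perturbations -/

section ExtremePoints

variable {X : Type*} [NormedAddCommGroup X] [NormedSpace ℝ X]

/-- A point of the unit ball is extreme iff it is not the midpoint of a nontrivial segment. -/
theorem mem_extremePoints_closedBall_iff {x : X} :
    x ∈ Set.extremePoints ℝ (closedBall (0 : X) 1) ↔
      ‖x‖ ≤ 1 ∧ ∀ d, ‖x + d‖ ≤ 1 → ‖x - d‖ ≤ 1 → d = 0 := by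
  rw [mem_extremePoints_iff_left]
  simp only [mem_closedBall_zero_iff]
  refine and_congr_right fun hx => ⟨fun h d h₁ h₂ => ?_, fun h y hy z hz hyz => ?_⟩
  · have := h _ h₁ _ h₂ ⟨1 / 2, 1 / 2, by norm_num, by norm_num, by norm_num, by module⟩
    simpa using this
  · obtain ⟨a, b, ha, hb, hab, rfl⟩ := hyz
    have hball : ∀ c : ℝ, 0 ≤ c → c ≤ 1 → ‖c • y + (1 - c) • z‖ ≤ 1 := fun c h0 h1 => by
      have := (convex_closedBall (0 : X) 1) (mem_closedBall_zero_iff.2 hy)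
        (mem_closedBall_zero_iff.2 hz) h0 (sub_nonneg.2 h1) (by ring)
      simpa using this
    have hb' : b = 1 - a := by linarith
    subst hb'
    -- Moving the coefficient a by this amount in either direction keeps it in [0, 1].
    have hm : 0 < min a (1 - a) := lt_min ha hb
    have h₁ := hball (a + min a (1 - a)) (by positivity)
      (by linarith [min_le_right a (1 - a)])
    have h₂ := hball (a - min a (1 - a)) (by linarith [min_le_left a (1 - a)])
      (by linarith [min_le_left a (1 - a)])
    have := h (min a (1 - a) • (y - z)) (by convert h₁ using 2; module)
      (by convert h₂ using 2; module)
    rcases smul_eq_zero.1 this with h0 | h0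
    · exact absurd h0 hm.ne'
    · rw [sub_eq_zero.1 h0]; module

theorem IsStronglyExtremePoint.mem_extremePoints {x : X} (h : IsStronglyExtremePoint x) :
    x ∈ Set.extremePoints ℝ (closedBall (0 : X) 1) := by
  refine mem_extremePoints_closedBall_iff.2 ⟨mem_closedBall_zero_iff.1 h.1, fun d h₁ h₂ => ?_⟩
  have := h.2 (fun _ => x + d) (fun _ => x - d) (fun _ => by simpa using h₁)
    (fun _ => by simpa using h₂) (by
      have : (1 / 2 : ℝ) • (x + d + (x - d)) = x := by module
      simp only [this, tendsto_const_nhds])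
  have h0 := tendsto_nhds_unique tendsto_const_nhds this
  have : (2 : ℝ) • d = 0 := by rw [← h0]; module
  simpa using this

end ExtremePoints

/-! ### Extreme points of the ball of a C⋆-algebra and strong extremality -/

namespace CStarAlgebra

variable {A : Type*} [CStarAlgebra A]

section Order

variable [PartialOrder A] [StarOrderedRing A]

theorem norm_le_one_iff_star_mul_self_le_one {a : A} : ‖a‖ ≤ 1 ↔ star a * a ≤ 1 := by
  rw [← norm_le_one_iff_of_nonneg _ (star_mul_self_nonneg a), CStarRing.norm_star_mul_self]
  exact ⟨fun h => mul_le_one₀ h (norm_nonneg _) h, fun h => by nlinarith [norm_nonneg a]⟩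

/-- Parallelogram law: (w + d)*(w + d) + (w - d)*(w - d) = 2(w*w + d*d). -/
theorem star_mul_self_le_one_sub_of_norm_le {w d : A} (h₁ : ‖w + d‖ ≤ 1) (h₂ : ‖w - d‖ ≤ 1) :
    star d * d ≤ 1 - star w * w := by
  rw [norm_le_one_iff_star_mul_self_le_one] at h₁ h₂
  have h := add_le_add h₁ h₂
  have h' : (2 : ℝ) • (star d * d + star w * w) ≤ (2 : ℝ) • (1 : A) := by
    convert h using 1
    · simp only [star_add, star_sub, mul_add, mul_sub, add_mul, sub_mul]; module
    · module
  rw [le_sub_iff_add_le]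
  exact (smul_le_smul_iff_of_pos_left two_pos).1 h'

end Order

/-- Perturbing x by ±(x - xx*x)/2 stays in the ball. One sign gives the mean of x and xx*x; the
other gives x(3 - x*x)/2, a contraction because 4 - p(3 - p)² = (1 - p)²(4 - p) ≥ 0 for p = x*x. -/
theorem mul_star_mul_self_of_mem_extremePoints {x : A}
    (hx : x ∈ Set.extremePoints ℝ (closedBall (0 : A) 1)) : x * star x * x = x := by
  rw [mem_extremePoints_closedBall_iff] at hx
  let _ := CStarAlgebra.spectralOrder A
  have := CStarAlgebra.spectralOrderedRing A
  obtain ⟨hx1, hx⟩ := hx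
  have hcube : ‖x * star x * x‖ ≤ 1 := by
    calc ‖x * star x * x‖ ≤ ‖x * star x‖ * ‖x‖ := norm_mul_le _ _
      _ ≤ 1 := mul_le_one₀ ((norm_mul_le _ _).trans
          (mul_le_one₀ hx1 (norm_nonneg _) (by rwa [norm_star]))) (norm_nonneg _) hx1
  have := hx ((1 / 2 : ℝ) • (x - x * star x * x)) ?_ ?_
  · rcases smul_eq_zero.1 this with h | h
    · norm_num at h
    · exact (sub_eq_zero.1 h).symm
  · have h0 : 0 ≤ 1 - star x * x := sub_nonneg.2 (norm_le_one_iff_star_mul_self_le_one.1 hx1)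
    have h1 : x + (1 / 2 : ℝ) • (x - x * star x * x) = (1 / 2 : ℝ) • (x * (3 - star x * x)) := by
      rw [mul_sub, show (3 : A) = 1 + 1 + 1 by norm_num, mul_add, mul_add, mul_one, ← mul_assoc]
      module
    have h2 : 1 - star (x * (3 - star x * x)) * (x * (3 - star x * x)) * (1 / 4 : ℝ) • 1 =
        (1 / 4 : ℝ) • (star (1 - star x * x) * (3 + (1 - star x * x)) * (1 - star x * x)) := by
      rw [show (1 : A) - _ = (1 / 4 : ℝ) • (4 - star (x * (3 - star x * x)) *
        (x * (3 - star x * x))) by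
          rw [show (4 : A) = 1 + 1 + 1 + 1 by norm_num, mul_smul_comm, mul_one]; module]
      congr 1
      simp only [star_mul, star_sub, star_one, star_star, star_ofNat]
      noncomm_ring
      rw [show (4 : A) = (4 : ℤ) • (1 : A) by simp]
      abel
    rw [norm_le_one_iff_star_mul_self_le_one, ← sub_nonneg, h1]
    convert (smul_nonneg (by norm_num : (0 : ℝ) ≤ 1 / 4)
      (star_left_conjugate_nonneg (add_nonneg (by norm_num : (0 : A) ≤ 3) h0)
        (1 - star x * x))) using 1
    rw [← h2, star_smul, smul_mul_smul_comm, mul_smul_comm, mul_one, star_trivial]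
    norm_num
  · have : x - (1 / 2 : ℝ) • (x - x * star x * x) = (1 / 2 : ℝ) • (x + x * star x * x) := by module
    rw [this, norm_smul]
    have := norm_add_le x (x * star x * x)
    norm_num
    linarith

/-- The element b = fae has range orthogonal to that of x and lives on the kernel of x, so adding a
contractive multiple of b to x, with either sign, leaves x in the ball. -/
theorem one_sub_mul_mul_one_sub_of_mem_extremePoints {x : A}
    (hx : x ∈ Set.extremePoints ℝ (closedBall (0 : A) 1)) (a : A) :
    (1 - x * star x) * a * (1 - star x * x) = 0 := by
  have hp := mul_star_mul_self_of_mem_extremePoints hx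
  rw [mem_extremePoints_closedBall_iff] at hx
  let _ := CStarAlgebra.spectralOrder A
  have := CStarAlgebra.spectralOrderedRing A
  obtain ⟨hx1, hx⟩ := hx
  set b := (1 - x * star x) * a * (1 - star x * x) with hb
  have hxf : star x * (1 - x * star x) = 0 := by
    simpa [mul_assoc, mul_sub, sub_eq_zero] using (congrArg star hp).symm
  have hxe : x * (1 - star x * x) = 0 := by
    rw [mul_sub, mul_one, ← mul_assoc, hp, sub_self]
  have he : (1 - star x * x) * (1 - star x * x) = 1 - star x * x := by
    rw [sub_mul, mul_assoc, hxe, mul_zero, sub_zero, one_mul]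
  have hxb : star x * b = 0 := by rw [hb, ← mul_assoc, ← mul_assoc, hxf, zero_mul, zero_mul]
  have hbx : star b * x = 0 := by simpa using congrArg star hxb
  have hbe : b * (1 - star x * x) = b := by rw [hb, mul_assoc, he]
  have key (r : ℝ) (hr : ‖r • b‖ ≤ 1) : ‖x + r • b‖ ≤ 1 := by
    rw [norm_le_one_iff_star_mul_self_le_one] at hr ⊢
    have := star_left_conjugate_le_conjugate hr (1 - star x * x)
    have hs : star (1 - star x * x) = 1 - star x * x := by simp
    have h1 : star (1 - star x * x) * (star (r • b) * (r • b)) * (1 - star x * x) =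
        star (r • b) * (r • b) := by
      have : r • b * (1 - star x * x) = r • b := by rw [smul_mul_assoc, hbe]
      rw [mul_assoc, mul_assoc, this, ← mul_assoc, ← star_mul, this]
    rw [h1, hs, mul_one, he] at this
    calc star (x + r • b) * (x + r • b) = star x * x + star (r • b) * (r • b) := by
          simp [mul_add, add_mul, hxb, hbx]
      _ ≤ star x * x + (1 - star x * x) := by gcongr
      _ = 1 := by abel
  have hr : ‖(‖b‖ + 1)⁻¹ • b‖ ≤ 1 := by
    rw [norm_smul, norm_inv, Real.norm_of_nonneg (by positivity), ← div_eq_inv_mul]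
    exact div_le_one_of_le₀ (by linarith) (by positivity)
  have h0 := hx ((‖b‖ + 1)⁻¹ • b) (key _ hr) (by
    rw [sub_eq_add_neg, ← neg_smul]
    exact key _ (by rwa [neg_smul, norm_neg]))
  exact (smul_eq_zero.1 h0).resolve_left (by positivity)

theorem isStronglyExtremePoint_of_mem_extremePoints {x : A}
    (hx : x ∈ Set.extremePoints ℝ (closedBall (0 : A) 1)) : IsStronglyExtremePoint x := by
  refine ⟨hx.1, fun y z hy hz h => ?_⟩
  let _ := CStarAlgebra.spectralOrder A
  have := CStarAlgebra.spectralOrderedRing A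
  have hp := mul_star_mul_self_of_mem_extremePoints hx
  have hp' : star x * x * star x = star x := by simpa [mul_assoc] using congrArg star hp
  set w : ℕ → A := fun n => (1 / 2 : ℝ) • (y n + z n)
  set d : ℕ → A := fun n => (1 / 2 : ℝ) • (y n - z n) with hd
  have h₁ n : ‖w n + d n‖ ≤ 1 := by
    have : w n + d n = y n := by simp only [w, d]; module
    simpa [this] using hy n
  have h₂ n : ‖w n - d n‖ ≤ 1 := by
    have : w n - d n = z n := by simp only [w, d]; module
    simpa [this] using hz n
  -- An order bound on a*a becomes a norm bound after compression by c. It is used with c = x*x and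
  -- c = xx*, both of which annihilate the limit of the right-hand side.
  have hnorm (a c b : A) (hab : star a * a ≤ b) : ‖a * c‖ ^ 2 ≤ ‖star c * b * c‖ := by
    rw [sq, ← CStarRing.norm_star_mul_self]
    refine norm_le_norm_of_nonneg_of_le (star_mul_self_nonneg _) ?_
    convert star_left_conjugate_le_conjugate hab c using 1
    simp [mul_assoc]
  have hsq (a : ℕ → A) (b : ℕ → A) (hab : ∀ n, ‖a n‖ ^ 2 ≤ ‖b n‖) (hb : Tendsto b atTop (𝓝 0)) :
      Tendsto a atTop (𝓝 0) := by
    rw [tendsto_zero_iff_norm_tendsto_zero] at hb ⊢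
    have := (squeeze_zero (fun n => sq_nonneg _) hab hb).sqrt
    simpa [Real.sqrt_sq] using this
  have hr : Tendsto (fun n => d n * (star x * x)) atTop (𝓝 0) := by
    refine hsq _ _ (fun n => hnorm _ _ _ (star_mul_self_le_one_sub_of_norm_le (h₁ n) (h₂ n))) ?_
    have : Tendsto (fun n => star (star x * x) * (1 - star (w n) * w n) * (star x * x)) atTop
        (𝓝 (star (star x * x) * (1 - star x * x) * (star x * x))) :=
      ((tendsto_const_nhds.sub (h.star.mul h)).const_mul _).mul_const _
    convert this using 2
    have : (1 - star x * x) * (star x * x) = 0 := by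
      rw [sub_mul, one_mul, ← mul_assoc, hp', sub_self]
    rw [mul_assoc, this, mul_zero]
  have hl : Tendsto (fun n => x * star x * d n) atTop (𝓝 0) := by
    have : Tendsto (fun n => star (d n) * (x * star x)) atTop (𝓝 0) := by
      refine hsq _ _ (fun n => hnorm _ _ _ (star_mul_self_le_one_sub_of_norm_le (w := star (w n))
        (by rw [← star_add, norm_star]; exact h₁ n)
        (by rw [← star_sub, norm_star]; exact h₂ n))) ?_
      have : Tendsto (fun n => star (x * star x) * (1 - star (star (w n)) * star (w n)) *
          (x * star x)) atTop
          (𝓝 (star (x * star x) * (1 - star (star x) * star x) * (x * star x))) :=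
        ((tendsto_const_nhds.sub (h.star.star.mul h.star)).const_mul _).mul_const _
      convert this using 2
      have : (1 - x * star x) * (x * star x) = 0 := by
        rw [sub_mul, one_mul, ← mul_assoc, hp, sub_self]
      rw [star_star, mul_assoc, this, mul_zero]
    simpa [mul_assoc] using this.star
  -- The missing corner fde of d vanishes, so the two pieces controlled above make up all of d.
  have hdec n : y n - z n = (2 : ℝ) • (x * star x * d n + (1 - x * star x) * (d n * (star x * x))) := by
    have h0 := one_sub_mul_mul_one_sub_of_mem_extremePoints hx (d n)
    have : x * star x * d n + (1 - x * star x) * (d n * (star x * x)) = d n := by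
      rw [mul_sub, mul_one, sub_eq_zero] at h0
      rw [← mul_assoc (1 - x * star x), ← h0]; noncomm_ring
    rw [this, hd]; module
  simp only [hdec]
  simpa using (hl.add (hr.const_mul (1 - x * star x))).const_smul (2 : ℝ)

/-- If an invertible element intertwines `x` and `y` and also their adjoints, then so does the
unitary of its polar decomposition. -/
theorem exists_unitary_of_intertwining {x y r : A} (hr : IsUnit r) (h₁ : r * x = y * r)
    (h₂ : star y * r = r * star x) : ∃ u ∈ unitary A, u * x = y * u := by
  let _ := CStarAlgebra.spectralOrder A
  have := CStarAlgebra.spectralOrderedRing A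
  have hunit : IsUnit (star r * r) := hr.star.mul hr
  have ha : 0 ≤ CFC.sqrt (star r * r) := CFC.sqrt_nonneg _
  have hau : IsUnit (CFC.sqrt (star r * r)) :=
    (CFC.isUnit_sqrt_iff _ (star_mul_self_nonneg r)).2 hunit
  have haa : CFC.sqrt (star r * r) * CFC.sqrt (star r * r) = star r * r :=
    CFC.sqrt_mul_sqrt_self _ (star_mul_self_nonneg r)
  have hcomm : Commute (CFC.sqrt (star r * r)) x := by
    have h₃ : star r * y = x * star r := by simpa using congrArg star h₂
    have : Commute (star r * r) x := by
      rw [commute_iff_eq, mul_assoc, h₁, ← mul_assoc, h₃, mul_assoc]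
    exact this.cfcₙ_nnreal _
  obtain ⟨a, haeq⟩ := hau
  rw [← haeq] at ha haa hcomm
  have hs : star (a : A) = a := ha.isSelfAdjoint
  have hsi : star (↑a⁻¹ : A) = ↑a⁻¹ := by
    have : star a = a := Units.ext hs
    rw [← Units.coe_star_inv, this]
  obtain ⟨r, rfl⟩ := hr
  refine ⟨r * ↑a⁻¹, ?_, ?_⟩
  · have h1 : star (↑r * (↑a⁻¹ : A)) * (↑r * ↑a⁻¹) = 1 := by
      rw [star_mul, hsi, mul_assoc, ← mul_assoc (star (r : A)), ← haa]; simp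
    exact (r * a⁻¹).isUnit.mem_unitary_of_star_mul_self h1
  · rw [mul_assoc, hcomm.units_inv_left.eq, ← mul_assoc, h₁, mul_assoc]

end CStarAlgebra

/-! ### C⋆-convex combinations representing an isometry -/

namespace IsProperCStarConvexCombination

variable {A : Type*} [CStarAlgebra A] {k : ℕ} {x : A} {y t : Fin k → A}

theorem mul_eq_mul_of_isometry (h : IsProperCStarConvexCombination x y t)
    (hy : ∀ i, ‖y i‖ ≤ 1) (hx : star x * x = 1) (i : Fin k) :
    y i * t i = t i * x ∧ star (y i) * y i = 1 := by
  let _ := CStarAlgebra.spectralOrder A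
  have := CStarAlgebra.spectralOrderedRing A
  obtain ⟨⟨h1, hxy⟩, hu⟩ := h
  have hle j : 0 ≤ star (t j) * (1 - star (y j) * y j) * t j :=
    star_left_conjugate_nonneg (sub_nonneg.2
      (CStarAlgebra.norm_le_one_iff_star_mul_self_le_one.1 (hy j))) _
  -- Expanding with x = ∑ t*yt and ∑ t*t = 1, the total collapses to 1 - x*x = 0, so each positive
  -- summand vanishes.
  have hsum : ∑ j, (star (y j * t j - t j * x) * (y j * t j - t j * x) +
      star (t j) * (1 - star (y j) * y j) * t j) = 0 := by
    have hx' : star x = ∑ j, star (t j) * star (y j) * t j := by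
      rw [hxy]; simp [star_sum, mul_assoc]
    have e1 j : star (y j * t j - t j * x) * (y j * t j - t j * x) +
        star (t j) * (1 - star (y j) * y j) * t j = star (t j) * t j +
        star x * (star (t j) * t j) * x - star x * (star (t j) * y j * t j)
          - (star (t j) * star (y j) * t j) * x := by
      simp only [star_sub, star_mul]; noncomm_ring
    simp only [e1, Finset.sum_sub_distrib, Finset.sum_add_distrib, ← Finset.mul_sum,
      ← Finset.sum_mul, h1, ← hxy, ← hx']
    simp [hx]
  have hz := (Finset.sum_eq_zero_iff_of_nonneg fun j _ =>
    add_nonneg (star_mul_self_nonneg _) (hle j)).1 hsum i (Finset.mem_univ _)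
  rw [add_eq_zero_iff_of_nonneg (star_mul_self_nonneg _) (hle i)] at hz
  refine ⟨sub_eq_zero.1 (CStarRing.star_mul_self_eq_zero_iff _ |>.1 hz.1), ?_⟩
  have := hz.2
  rw [(hu i).mul_left_eq_zero, (hu i).star.mul_right_eq_zero] at this
  exact (sub_eq_zero.1 this).symm

end IsProperCStarConvexCombination

/-! ### Similar isometries and their common intertwiner -/

/-- The approximants of an operator that intertwines two isometries `x` and `y` and their adjoints,
built from an element `t` with inverse `t'` that intertwines `x` and `y` only. -/
def approxIntertwiner {A : Type*} [Ring A] [StarRing A] (x y t t' : A) : ℕ → A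
  | 0 => t
  | n + 1 => star t' * (1 - x * star x) + y * approxIntertwiner x y t t' n * star x

namespace approxIntertwiner

section Ring

variable {A : Type*} [Ring A] [StarRing A] {x y t t' : A}

/-- The recursion is affine with linear part a ↦ y a x*, so it transports differences from index 0
to index m. -/
theorem add_sub_eq (m k : ℕ) :
    approxIntertwiner x y t t' (m + k) - approxIntertwiner x y t t' m =
      y ^ m * (approxIntertwiner x y t t' k - t) * star x ^ m := by
  induction m with
  | zero => simp [approxIntertwiner]
  | succ m ih =>
    rw [Nat.succ_add, approxIntertwiner, approxIntertwiner, add_sub_add_left_eq_sub, ← sub_mul,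
      ← mul_sub, ih, pow_succ', pow_succ]
    simp only [mul_assoc]

theorem mul_pow_eq (hx : star x * x = 1) (n : ℕ) :
    approxIntertwiner x y t t' n * x ^ n = y ^ n * t := by
  induction n with
  | zero => simp [approxIntertwiner]
  | succ n ih =>
    have h0 : (1 - x * star x) * x = 0 := by rw [sub_mul, mul_assoc, hx]; simp
    rw [approxIntertwiner, add_mul, pow_succ', ← mul_assoc, mul_assoc (star t'), h0,
      ← mul_assoc, mul_assoc (y * _) (star x), hx, mul_one, mul_assoc y, ih, pow_succ']
    simp [mul_assoc]

/-- Exchanging x with y and t with t' produces the inverse: t'* and t* match ker x* with ker y*, and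
the remaining term is the conjugate by y of the previous product. -/
theorem mul_swap_eq_one (hx : star x * x = 1) (hy : star y * y = 1) (h : t * t' = 1)
    (ht : t * x = y * t) (n : ℕ) :
    approxIntertwiner x y t t' n * approxIntertwiner y x t' t n = 1 := by
  induction n with
  | zero => exact h
  | succ n ih =>
    have h1 : (1 - x * star x) * x = 0 := by rw [sub_mul, mul_assoc, hx]; simp
    have h2 : star x * star t = star t * star y := by simpa using congrArg star ht
    have h3 : star y * (1 - y * star y) = 0 := by rw [mul_sub, ← mul_assoc, hy]; simp
    have h4 : star t' * star t = 1 := by simpa using congrArg star h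
    have h5 : star x * (star t * (1 - y * star y)) = 0 := by
      rw [← mul_assoc, h2, mul_assoc, h3, mul_zero]
    calc approxIntertwiner x y t t' (n + 1) * approxIntertwiner y x t' t (n + 1)
        = star t' * (star t * (1 - y * star y)) -
            star t' * x * (star x * (star t * (1 - y * star y))) +
          star t' * ((1 - x * star x) * x) * approxIntertwiner y x t' t n * star y +
          y * approxIntertwiner x y t t' n * (star x * (star t * (1 - y * star y))) +
          y * approxIntertwiner x y t t' n * (star x * x) *
            approxIntertwiner y x t' t n * star y := by
          simp only [approxIntertwiner]; noncomm_ring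
      _ = (1 - y * star y) + y * (approxIntertwiner x y t t' n *
            approxIntertwiner y x t' t n) * star y := by
          rw [h1, h5, hx, ← mul_assoc (star t'), h4]; simp [mul_assoc]
      _ = 1 := by rw [ih]; simp

end Ring

/-- The two summands of the recursion have orthogonal ranges, in ker y* and in the range of y, and
act on the orthogonal projections 1 - xx* and xx*. Their bounds therefore combine as a maximum. -/
theorem norm_le {A : Type*} [CStarAlgebra A] {x y t t' : A} (hx : star x * x = 1)
    (hy : star y * y = 1) (h : t * t' = 1) (h' : t' * t = 1) (ht : t * x = y * t) (n : ℕ) :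
    ‖approxIntertwiner x y t t' n‖ ≤ max ‖t‖ ‖t'‖ := by
  let _ := CStarAlgebra.spectralOrder A
  have := CStarAlgebra.spectralOrderedRing A
  induction n with
  | zero => exact le_max_left _ _
  | succ n ih =>
    have h1 : star x * (1 - x * star x) = 0 := by rw [mul_sub, ← mul_assoc, hx]; simp
    have h2 : star y * star t' = star t' * star x := by
      have : t' * y = x * t' := by
        calc t' * y = t' * (y * t) * t' := by rw [mul_assoc, mul_assoc, h, mul_one]
          _ = x * t' := by rw [← ht, ← mul_assoc, h', one_mul]
      simpa using (congrArg star this)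
    have h3 : star y * (star t' * (1 - x * star x)) = 0 := by
      rw [← mul_assoc, h2, mul_assoc, h1, mul_zero]
    have h4 : (1 - x * star x) * t' * y = 0 := by simpa [mul_assoc] using congrArg star h3
    set c := max ‖t‖ ‖t'‖ with hc
    have hc0 : 0 ≤ c := (norm_nonneg t).trans (le_max_left _ _)
    set r := approxIntertwiner x y t t' n
    have he : (1 - x * star x) * (1 - x * star x) = 1 - x * star x := by
      rw [sub_mul, mul_assoc, h1]; simp
    have hes : star (1 - x * star x) = 1 - x * star x := by simp
    have key : star (approxIntertwiner x y t t' (n + 1)) * approxIntertwiner x y t t' (n + 1) =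
        star (1 - x * star x) * (star (star t') * star t') * (1 - x * star x) +
          star (star x) * (star r * r) * star x := by
      calc _ = star (1 - x * star x) * (star (star t') * star t') * (1 - x * star x) +
          ((1 - x * star x) * t' * y) * r * star x +
          x * star r * (star y * (star t' * (1 - x * star x))) +
          x * star r * (star y * y) * r * star x := by
            rw [approxIntertwiner, star_add, star_mul, star_mul, star_mul, star_star, hes, star_star]
            noncomm_ring
        _ = _ := by rw [h3, h4, hy]; simp [mul_assoc]
    have hb (a b : A) (ha : ‖a‖ ≤ c) : star b * (star a * a) * b ≤ c ^ 2 • (star b * b) := by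
      refine (CStarAlgebra.star_left_conjugate_le_norm_smul (star_mul_self_nonneg a).isSelfAdjoint).trans ?_
      rw [CStarRing.norm_star_mul_self, ← sq]
      exact smul_le_smul_of_nonneg_right (by gcongr) (star_mul_self_nonneg b)
    have hle : star (approxIntertwiner x y t t' (n + 1)) * approxIntertwiner x y t t' (n + 1) ≤
        c ^ 2 • (1 : A) := by
      rw [key]
      refine (add_le_add (hb _ _ (by rw [norm_star]; exact le_max_right _ _)) (hb _ _ ih)).trans ?_
      rw [← smul_add, hes, he, star_star, sub_add_cancel]
    have := CStarAlgebra.norm_le_norm_of_nonneg_of_le (star_mul_self_nonneg _) hle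
    rw [CStarRing.norm_star_mul_self, norm_smul, Real.norm_of_nonneg (by positivity)] at this
    have h1 : ‖(1 : A)‖ ≤ 1 := by
      rw [CStarAlgebra.norm_le_one_iff_star_mul_self_le_one]; simp
    exact abs_le_of_sq_le_sq' (by nlinarith [sq_nonneg c]) hc0 |>.2

section Operator

variable {H : Type*} [NormedAddCommGroup H] [InnerProductSpace ℂ H] [CompleteSpace H]
  {x y t t' : H →L[ℂ] H}

theorem _root_.ContinuousLinearMap.norm_map_of_star_mul_self_eq_one (hx : star x * x = 1) (v : H) :
    ‖x v‖ = ‖v‖ :=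
  (ContinuousLinearMap.norm_map_iff_adjoint_comp_self x).2 hx v

theorem _root_.ContinuousLinearMap.norm_sub_sq_of_star_mul_self_eq_one (hx : star x * x = 1)
    (v : H) : ‖v - x (star x v)‖ ^ 2 = ‖v‖ ^ 2 - ‖star x v‖ ^ 2 := by
  have h1 := ContinuousLinearMap.norm_map_of_star_mul_self_eq_one hx (star x v)
  have h2 : inner ℂ v (x (star x v)) = inner ℂ (star x v) (star x v) :=
    (ContinuousLinearMap.adjoint_inner_left x _ _).symm
  rw [@norm_sub_sq ℂ, h2, h1, inner_self_eq_norm_sq]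
  ring

/-- The squared increments are controlled by those of ‖x*ⁿv‖², a decreasing sequence bounded below.
-/
theorem cauchySeq_apply (hx : star x * x = 1) (hy : star y * y = 1) (h : t * t' = 1)
    (h' : t' * t = 1) (ht : t * x = y * t) (v : H) :
    CauchySeq fun n => approxIntertwiner x y t t' n v := by
  set c := max ‖t‖ ‖t'‖ with hc
  have hc0 : 0 ≤ c := (norm_nonneg t).trans (le_max_left _ _)
  have hpow {z : H →L[ℂ] H} (hz : star z * z = 1) (n : ℕ) : star (z ^ n) * z ^ n = 1 := by
    induction n with
    | zero => simp
    | succ n ih => rw [pow_succ', star_mul, mul_assoc, ← mul_assoc (star z), hz, one_mul, ih]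
  have key (m k : ℕ) : ‖(approxIntertwiner x y t t' (m + k) - approxIntertwiner x y t t' m) v‖ ^ 2
      ≤ (2 * c) ^ 2 * (‖(star x ^ m) v‖ ^ 2 - ‖(star x ^ (m + k)) v‖ ^ 2) := by
    -- The k-th approximant agrees with t on the range of xᵏ, so only the complementary projection
    -- contributes.
    have h1 : (approxIntertwiner x y t t' k - t) * (1 - x ^ k * star (x ^ k)) =
        approxIntertwiner x y t t' k - t := by
      have : t * x ^ k = y ^ k * t := by
        exact (SemiconjBy.pow_right (a := t) (x := x) (y := y) ht k).eq
      rw [mul_sub, mul_one, ← mul_assoc, sub_mul _ t (x ^ k), mul_pow_eq hx, this]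
      simp
    rw [add_sub_eq, ← h1, add_comm m k, pow_add, ← star_pow x k]
    set w := (star x ^ m) v with hw
    have h2 : ‖((y ^ m * ((approxIntertwiner x y t t' k - t) * (1 - x ^ k * star (x ^ k))) *
        star x ^ m) v)‖ ≤ 2 * c * ‖w - (x ^ k) (star (x ^ k) w)‖ := by
      calc _ = ‖(approxIntertwiner x y t t' k - t) (w - (x ^ k) (star (x ^ k) w))‖ :=
            ContinuousLinearMap.norm_map_of_star_mul_self_eq_one (hpow hy m) _
        _ ≤ ‖approxIntertwiner x y t t' k - t‖ * ‖w - (x ^ k) (star (x ^ k) w)‖ :=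
            ContinuousLinearMap.le_opNorm _ _
        _ ≤ _ := by
            gcongr
            refine (norm_sub_le _ _).trans ?_
            have := norm_le hx hy h h' ht k
            linarith [le_max_left ‖t‖ ‖t'‖]
    calc _ ≤ (2 * c * ‖w - (x ^ k) (star (x ^ k) w)‖) ^ 2 := by gcongr
      _ = _ := by
        rw [mul_pow, ContinuousLinearMap.norm_sub_sq_of_star_mul_self_eq_one (hpow hx k)]; rfl
  have hanti : Antitone fun n => ‖(star x ^ n) v‖ ^ 2 := by
    refine antitone_nat_of_succ_le fun n => ?_
    have := ContinuousLinearMap.norm_sub_sq_of_star_mul_self_eq_one hx ((star x ^ n) v)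
    rw [pow_succ' (star x) n]
    have h0 := sq_nonneg ‖(star x ^ n) v - x (star x ((star x ^ n) v))‖
    rw [this] at h0
    exact sub_nonneg.1 h0
  have hcau : CauchySeq fun n => ‖(star x ^ n) v‖ ^ 2 :=
    (tendsto_atTop_ciInf hanti ⟨0, by rintro _ ⟨n, rfl⟩; positivity⟩).cauchySeq
  rw [Metric.cauchySeq_iff'] at hcau ⊢
  intro ε hε
  -- The added 1 guards against c = 0, which occurs when H is trivial.
  obtain ⟨N, hN⟩ := hcau ((ε / (2 * c + 1)) ^ 2) (by positivity)
  refine ⟨N, fun n hn => ?_⟩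
  obtain ⟨k, rfl⟩ := Nat.exists_eq_add_of_le hn
  have h1 := hN _ hn
  rw [dist_comm, Real.dist_eq, abs_of_nonneg (sub_nonneg.2 (hanti hn))] at h1
  rw [dist_eq_norm]
  refine lt_of_pow_lt_pow_left₀ 2 hε.le ?_
  have hp : 0 < (2 * c + 1) ^ 2 := by positivity
  calc _ ≤ (2 * c) ^ 2 * (‖(star x ^ N) v‖ ^ 2 - ‖(star x ^ (N + k)) v‖ ^ 2) := key N k
    _ ≤ (2 * c + 1) ^ 2 * (‖(star x ^ N) v‖ ^ 2 - ‖(star x ^ (N + k)) v‖ ^ 2) :=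
        mul_le_mul_of_nonneg_right (by gcongr; linarith) (sub_nonneg.2 (hanti hn))
    _ < (2 * c + 1) ^ 2 * (ε / (2 * c + 1)) ^ 2 := by gcongr
    _ = ε ^ 2 := by field_simp

end Operator

end approxIntertwiner

/-! ### Strong limits of intertwiners inside a von Neumann algebra -/

namespace VonNeumannAlgebra

variable {H : Type*} [NormedAddCommGroup H] [InnerProductSpace ℂ H] [CompleteSpace H]
  (M : VonNeumannAlgebra H)

theorem mem_iff_forall_commutant {a : H →L[ℂ] H} :
    a ∈ M ↔ ∀ b ∈ M.commutant, b * a = a * b := by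
  rw [← mem_commutant_iff, commutant_commutant]

theorem exists_mem_tendsto_of_cauchySeq {a : ℕ → H →L[ℂ] H} (ha : ∀ n, a n ∈ M)
    (hc : ∀ v, CauchySeq fun n => a n v) :
    ∃ b ∈ M, ∀ v, Tendsto (fun n => a n v) atTop (𝓝 (b v)) := by
  choose f hf using fun v => cauchySeq_tendsto_of_complete (hc v)
  have hf' : Tendsto (fun n v => a n v) atTop (𝓝 f) := tendsto_pi_nhds.2 hf
  refine ⟨continuousLinearMapOfTendsto a hf', ?_, hf⟩
  refine M.mem_iff_forall_commutant.2 fun b hb => ContinuousLinearMap.ext fun v => ?_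
  refine tendsto_nhds_unique ((b.continuous.tendsto _).comp (hf v)) ?_
  refine (hf (b v)).congr fun n => ?_
  exact DFunLike.congr_fun (mem_commutant_iff.1 hb _ (ha n)) v

theorem _root_.approxIntertwiner.mem {x y t t' : H →L[ℂ] H} (hx : x ∈ M) (hy : y ∈ M) (ht : t ∈ M)
    (ht' : t' ∈ M) (n : ℕ) : approxIntertwiner x y t t' n ∈ M := by
  induction n with
  | zero => exact ht
  | succ n ih =>
    exact add_mem (mul_mem (star_mem ht') (sub_mem (one_mem _) (mul_mem hx (star_mem hx))))
      (mul_mem (mul_mem hy ih) (star_mem hx))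

/-- Similar isometries of a von Neumann algebra are intertwined, together with their adjoints, by
an invertible element. -/
theorem exists_intertwining {x y t t' : H →L[ℂ] H} (hxM : x ∈ M) (hyM : y ∈ M) (htM : t ∈ M)
    (htM' : t' ∈ M) (hx : star x * x = 1) (hy : star y * y = 1) (h : t * t' = 1) (h' : t' * t = 1)
    (ht : t * x = y * t) :
    ∃ r ∈ M, ∃ r' ∈ M, r * r' = 1 ∧ r' * r = 1 ∧ r * x = y * r ∧ star y * r = r * star x := by
  have ht' : t' * y = x * t' := by
    calc t' * y = t' * (y * t) * t' := by rw [mul_assoc, mul_assoc, h, mul_one]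
      _ = x * t' := by rw [← ht, ← mul_assoc, h', one_mul]
  obtain ⟨r, hrM, hr⟩ := M.exists_mem_tendsto_of_cauchySeq
    (approxIntertwiner.mem M hxM hyM htM htM') (approxIntertwiner.cauchySeq_apply hx hy h h' ht)
  obtain ⟨r', hrM', hr'⟩ := M.exists_mem_tendsto_of_cauchySeq
    (approxIntertwiner.mem M hyM hxM htM' htM) (approxIntertwiner.cauchySeq_apply hy hx h' h ht')
  -- Products pass to strong limits because the left factors are uniformly bounded.
  have hinv {a b : ℕ → H →L[ℂ] H} {p q : H →L[ℂ] H} (C : ℝ) (hC : ∀ n, ‖a n‖ ≤ C)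
      (hab : ∀ n, a n * b n = 1) (hp : ∀ v, Tendsto (fun n => a n v) atTop (𝓝 (p v)))
      (hq : ∀ v, Tendsto (fun n => b n v) atTop (𝓝 (q v))) : p * q = 1 := by
    refine ContinuousLinearMap.ext fun v => tendsto_nhds_unique (hp (q v)) ?_
    have h0 : Tendsto (fun n => a n (q v - b n v)) atTop (𝓝 0) := by
      refine squeeze_zero_norm (a := fun n => C * ‖q v - b n v‖)
        (fun n => ((a n).le_opNorm _).trans (by gcongr; exact hC n)) ?_
      have := ((tendsto_const_nhds (x := q v)).sub (hq v)).norm.const_mul C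
      simpa using this
    have := h0.add_const v
    rw [zero_add] at this
    refine this.congr fun n => ?_
    have hv : a n (b n v) = v := DFunLike.congr_fun (hab n) v
    rw [map_sub, hv, sub_add_cancel]
  -- The limit is a fixed point of the recursion; multiplying by x on the right or by y* on the left
  -- yields the two intertwining relations.
  have hfix : r = star t' * (1 - x * star x) + y * r * star x := by
    refine ContinuousLinearMap.ext fun v => tendsto_nhds_unique ((hr v).comp (tendsto_add_atTop_nat 1)) ?_
    exact ((y.continuous.tendsto _).comp (hr (star x v))).const_add
      ((star t' * (1 - x * star x)) v)
  refine ⟨r, hrM, r', hrM', ?_, ?_, ?_, ?_⟩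
  · exact hinv _ (approxIntertwiner.norm_le hx hy h h' ht)
      (approxIntertwiner.mul_swap_eq_one hx hy h ht) hr hr'
  · exact hinv _ (approxIntertwiner.norm_le hy hx h' h ht')
      (approxIntertwiner.mul_swap_eq_one hy hx h' ht') hr' hr
  · have h0 : (1 - x * star x) * x = 0 := by rw [sub_mul, mul_assoc, hx]; simp
    conv_lhs => rw [hfix]
    rw [add_mul, mul_assoc, h0, mul_zero, zero_add, mul_assoc, hx, mul_one]
  · have h1 : star y * star t' = star t' * star x := by simpa using congrArg star ht'
    have h0 : star x * (1 - x * star x) = 0 := by rw [mul_sub, ← mul_assoc, hx]; simp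
    conv_lhs => rw [hfix]
    rw [mul_add, ← mul_assoc, h1, mul_assoc, h0, mul_zero, zero_add, ← mul_assoc, ← mul_assoc, hy,
      one_mul]

end VonNeumannAlgebra

/-! ### Central separation and similarity inside M -/

namespace VonNeumannAlgebra

variable {H : Type*} [NormedAddCommGroup H] [InnerProductSpace ℂ H] [CompleteSpace H]
  (M : VonNeumannAlgebra H)

/-- If `f * a * e = 0` for all `a` in a von Neumann algebra, then `e` and `f` are separated by a
central projection, the central support of `f`. -/
theorem exists_central_projection {e f : H →L[ℂ] H} (hf : f ∈ M) (hfs : star f = f)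
    (h : ∀ a ∈ M, f * a * e = 0) :
    ∃ z ∈ M, IsStarProjection z ∧ (∀ a ∈ M, z * a = a * z) ∧ z * f = f ∧ z * e = 0 := by
  set S : Set H := {w | ∃ a ∈ M, ∃ v, a (f v) = w} with hS
  set K := (Submodule.span ℂ S).topologicalClosure with hK
  have : CompleteSpace K :=
    (Submodule.isClosed_topologicalClosure _).completeSpace_coe
  have hKle {L : Submodule ℂ H} (hL : IsClosed (L : Set H)) (hSL : S ⊆ L) : K ≤ L :=
    Submodule.topologicalClosure_minimal _ (Submodule.span_le.2 hSL) hL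
  have hSK : S ⊆ K := Submodule.subset_span.trans (Submodule.le_topologicalClosure _)
  have hinv {b : H →L[ℂ] H} (hb : ∀ w ∈ S, b w ∈ S) : K ∈ Module.End.invtSubmodule b := by
    rw [Module.End.mem_invtSubmodule]
    refine hKle ?_ fun w hw => hSK (hb w hw)
    exact (Submodule.isClosed_topologicalClosure _).preimage b.continuous
  have hz : IsStarProjection K.starProjection := isStarProjection_starProjection
  refine ⟨K.starProjection, ?_, hz, ?_, ?_, ?_⟩
  -- A projection lies in M when its range is invariant under the commutant. The closed span K of M
  -- f H is invariant under both the commutant and M, so the projection is central.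
  · rw [IsStarProjection.mem_iff hz]
    intro b hb
    rw [Submodule.range_starProjection]
    refine hinv ?_
    rintro _ ⟨a, ha, v, rfl⟩
    refine ⟨a, ha, b v, ?_⟩
    have h1 : a * f * b = b * (a * f) := mem_commutant_iff.1 hb _ (mul_mem ha hf)
    exact DFunLike.congr_fun h1 v
  · have : K.starProjection ∈ M.commutant := by
      rw [IsStarProjection.mem_iff hz]
      intro b hb
      rw [Submodule.range_starProjection]
      rw [commutant_commutant] at hb
      refine hinv ?_
      rintro _ ⟨a, ha, v, rfl⟩
      exact ⟨b * a, mul_mem hb ha, v, rfl⟩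
    exact fun a ha => (mem_commutant_iff.1 this a ha).symm
  · ext v
    exact Submodule.starProjection_eq_self_iff.2 (hSK ⟨1, one_mem _, v, rfl⟩)
  · ext w
    refine (Submodule.starProjection_apply_eq_zero_iff _).2 ?_
    refine (Submodule.mem_orthogonal' _ _).2 fun u hu => ?_
    have hle : K ≤ (innerSL ℂ (e w)).ker := by
      refine hKle (innerSL ℂ (e w)).isClosed_ker ?_
      rintro _ ⟨a, ha, v, rfl⟩
      have h1 : star (f * star a * e) = 0 := by rw [h _ (star_mem ha), star_zero]
      have h2 : star e * (a * f) = 0 := by simpa [hfs, mul_assoc] using h1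
      have h3 : star e (a (f v)) = 0 := DFunLike.congr_fun h2 v
      change inner ℂ (e w) (a (f v)) = 0
      rw [← ContinuousLinearMap.adjoint_inner_right, ← ContinuousLinearMap.star_eq_adjoint, h3,
        inner_zero_right]
    exact hle hu

theorem exists_unitary_of_similar_isometries {x y t : M.toStarSubalgebra} (hx : star x * x = 1)
    (hy : star y * y = 1) (ht : IsUnit t) (htx : t * x = y * t) :
    ∃ u ∈ unitary M.toStarSubalgebra, u * x = y * u := by
  obtain ⟨t, rfl⟩ := ht
  obtain ⟨r, hr, r', hr', h1, h2, h3, h4⟩ := M.exists_intertwining x.2 y.2 (t : M.toStarSubalgebra).2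
    (↑t⁻¹ : M.toStarSubalgebra).2 (congrArg Subtype.val hx) (congrArg Subtype.val hy)
    (congrArg Subtype.val t.mul_inv) (congrArg Subtype.val t.inv_mul) (congrArg Subtype.val htx)
  exact CStarAlgebra.exists_unitary_of_intertwining (x := x) (y := y) (r := ⟨r, hr⟩)
    ⟨⟨⟨r, hr⟩, ⟨r', hr'⟩, Subtype.ext h1, Subtype.ext h2⟩, rfl⟩
    (Subtype.ext h3) (Subtype.ext h4)

end VonNeumannAlgebra

/-! ### Cutting by a central projection and filling the complement with the identity -/

section CentralProjection

variable {A : Type*} [CStarAlgebra A] {z : A}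

theorem CStarAlgebra.norm_mul_add_one_sub_le_one (hz : IsStarProjection z) (hc : ∀ a, z * a = a * z)
    {a : A} (ha : ‖a‖ ≤ 1) : ‖a * z + (1 - z)‖ ≤ 1 := by
  let _ := CStarAlgebra.spectralOrder A
  have := CStarAlgebra.spectralOrderedRing A
  rw [norm_le_one_iff_star_mul_self_le_one] at ha ⊢
  have h := star_left_conjugate_le_conjugate ha z
  have hzz : z * z = z := hz.isIdempotentElem
  have hzs : star z = z := hz.isSelfAdjoint
  have h1 : z * (1 - z) = 0 := by rw [mul_sub, hzz, mul_one, sub_self]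
  have h2 : (1 - z) * z = 0 := by rw [sub_mul, hzz, one_mul, sub_self]
  calc star (a * z + (1 - z)) * (a * z + (1 - z))
      = star z * (star a * a) * z + z * (star a * ((1 - z))) + (1 - z) * (a * z)
          + (1 - z) * (1 - z) := by
        simp only [star_add, star_mul, star_sub, star_one, hzs]; noncomm_ring
    _ = star z * (star a * a) * z + (1 - z) := by
        rw [← hc a, ← mul_assoc (1 - z), h2, ← mul_assoc z, hc (star a), mul_assoc (star a), h1,
          mul_sub (1 - z), h2]
        simp
    _ ≤ star z * 1 * z + (1 - z) := by gcongr
    _ = 1 := by rw [hzs, mul_one, hzz]; abel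

theorem IsStarProjection.star_mul_self_mul_add_one_sub (hz : IsStarProjection z)
    (hc : ∀ a, z * a = a * z) {x : A} (hx : z * (1 - star x * x) = 0) :
    star (x * z + (1 - z)) * (x * z + (1 - z)) = 1 := by
  have hzz : z * z = z := hz.isIdempotentElem
  have hzs : star z = z := hz.isSelfAdjoint
  have h1 : z * (1 - z) = 0 := by rw [mul_sub, hzz, mul_one, sub_self]
  have h2 : (1 - z) * z = 0 := by rw [sub_mul, hzz, one_mul, sub_self]
  have hx' : z * (star x * x) = z := by rw [mul_sub, mul_one, sub_eq_zero] at hx; exact hx.symm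
  calc star (x * z + (1 - z)) * (x * z + (1 - z))
      = z * (star x * x) * z + z * (star x * ((1 - z))) + (1 - z) * (x * z)
          + (1 - z) * (1 - z) := by
        simp only [star_add, star_mul, star_sub, star_one, hzs]; noncomm_ring
    _ = 1 := by
        rw [hx', ← hc x, ← mul_assoc (1 - z), h2, ← mul_assoc z, hc (star x), mul_assoc (star x), h1,
          mul_sub (1 - z), h2, hzz]
        simp

namespace IsProperCStarConvexCombination

variable {k : ℕ} {x : A} {y t : Fin k → A}

theorem star (h : IsProperCStarConvexCombination x y t) :
    IsProperCStarConvexCombination (star x) (fun i => star (y i)) t := by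
  obtain ⟨⟨h1, rfl⟩, h2⟩ := h
  exact ⟨⟨h1, by simp [star_sum, mul_assoc]⟩, h2⟩

theorem mul_add_one_sub (h : IsProperCStarConvexCombination x y t) (hc : ∀ a, z * a = a * z) :
    IsProperCStarConvexCombination (x * z + (1 - z)) (fun i => y i * z + (1 - z)) t := by
  obtain ⟨⟨h1, rfl⟩, h2⟩ := h
  refine ⟨⟨h1, ?_⟩, h2⟩
  have hc' a : (1 - z) * a = a * (1 - z) := by rw [sub_mul, mul_sub, hc, one_mul, mul_one]
  calc _ = (∑ i, Star.star (t i) * y i * t i) * z + (∑ i, Star.star (t i) * t i) * (1 - z) := by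
        rw [h1, one_mul]
    _ = _ := by
        rw [Finset.sum_mul, Finset.sum_mul, ← Finset.sum_add_distrib]
        refine Finset.sum_congr rfl fun i _ => ?_
        simp only [mul_add, add_mul, mul_assoc, hc (t i), hc' (t i)]

end IsProperCStarConvexCombination

end CentralProjection

/-! ### Extreme points are C⋆-extreme -/

namespace VonNeumannAlgebra

variable {H : Type*} [NormedAddCommGroup H] [InnerProductSpace ℂ H] [CompleteSpace H]
  {M : VonNeumannAlgebra H}

theorem isCStarExtremePoint_of_mem_extremePoints {x : M.toStarSubalgebra}
    (hx : x ∈ Set.extremePoints ℝ (closedBall (0 : M.toStarSubalgebra) 1)) :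
    IsCStarExtremePoint x := by
  refine ⟨hx.1, fun k y t hy h i => ?_⟩
  simp only [mem_closedBall_zero_iff] at hy
  have hiso {x : M.toStarSubalgebra} {y : Fin k → M.toStarSubalgebra}
      (h : IsProperCStarConvexCombination x y t) (hy : ∀ i, ‖y i‖ ≤ 1) (hx : star x * x = 1) :
      ∃ u ∈ unitary M.toStarSubalgebra, u * x = y i * u := by
    obtain ⟨h1, h2⟩ := h.mul_eq_mul_of_isometry hy hx i
    exact M.exists_unitary_of_similar_isometries hx h2 (h.2 i) h1.symm
  have hfe := CStarAlgebra.one_sub_mul_mul_one_sub_of_mem_extremePoints hx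
  obtain ⟨z, hzM, hz, hzc, hzf, hze⟩ := M.exists_central_projection
    (e := ((1 - star x * x : M.toStarSubalgebra) : H →L[ℂ] H))
    (f := ((1 - x * star x : M.toStarSubalgebra) : H →L[ℂ] H)) (Subtype.prop _)
    (congrArg Subtype.val (by simp : star (1 - x * star x) = 1 - x * star x))
    (fun a ha => congrArg Subtype.val (hfe ⟨a, ha⟩))
  lift z to M.toStarSubalgebra using hzM
  replace hz : IsStarProjection z :=
    ⟨Subtype.ext hz.isIdempotentElem, Subtype.ext hz.isSelfAdjoint⟩
  replace hzc (a : M.toStarSubalgebra) : z * a = a * z := Subtype.ext (hzc a a.2)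
  replace hzf : z * (1 - x * star x) = 1 - x * star x := Subtype.ext hzf
  replace hze : z * (1 - star x * x) = 0 := Subtype.ext hze
  have hzc' (a : M.toStarSubalgebra) : (1 - z) * a = a * (1 - z) := by
    rw [sub_mul, mul_sub, hzc, one_mul, mul_one]
  have hz' := hz.one_sub
  have hzz : z * z = z := hz.isIdempotentElem
  have hzs : star z = z := hz.isSelfAdjoint
  have h01 : z * (1 - z) = 0 := by rw [mul_sub, hzz, mul_one, sub_self]
  have h10 : (1 - z) * z = 0 := by rw [sub_mul, hzz, one_mul, sub_self]
  have h11 : (1 - z) * (1 - z) = 1 - z := hz'.isIdempotentElem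
  -- Filled up with 1 - z, the z-part of x is an isometry of M; on the other side the same holds for
  -- x*.
  obtain ⟨u, hu, hux⟩ := hiso (h.mul_add_one_sub hzc)
    (fun i => CStarAlgebra.norm_mul_add_one_sub_le_one hz hzc (hy i))
    (hz.star_mul_self_mul_add_one_sub hzc hze)
  obtain ⟨v, hv, hvx⟩ := hiso (h.star.mul_add_one_sub hzc')
    (fun i => CStarAlgebra.norm_mul_add_one_sub_le_one hz' hzc' (by rw [norm_star]; exact hy i))
    (hz'.star_mul_self_mul_add_one_sub hzc' (by rw [star_star, sub_mul, hzf]; simp))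
  have hux' : u * x * z = y i * u * z := by
    have := congrArg (· * z) hux
    have e1 : z * (u * z) = u * z := by rw [← mul_assoc, hzc, mul_assoc, hzz]
    have e2 : (1 - z) * (u * z) = 0 := by rw [← mul_assoc, hzc', mul_assoc, h10, mul_zero]
    simpa [mul_add, add_mul, mul_assoc, hzz, h10, e1, e2] using this
  have hvx' : v * x * (1 - z) = y i * v * (1 - z) := by
    have h1 : v * star x * (1 - z) = star (y i) * v * (1 - z) := by
      have := congrArg (· * (1 - z)) hvx
      simp only [sub_sub_cancel, mul_add, add_mul, mul_assoc, h11, h01, mul_zero, add_zero] at this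
      have e1 : (1 - z) * (v * (1 - z)) = v * (1 - z) := by rw [← mul_assoc, hzc', mul_assoc, h11]
      have e2 : z * (v * (1 - z)) = 0 := by rw [← mul_assoc, hzc, mul_assoc, h01, mul_zero]
      simpa only [mul_assoc, e1, e2, add_zero] using this
    have h2 : (1 - z) * (x * star v) = (1 - z) * (star v * y i) := by
      simpa [hzs, mul_assoc] using congrArg star h1
    -- Unitarity of v turns the relation for x* and `star (y i)` into the one for x and `y i`.
    calc v * x * (1 - z) = v * ((1 - z) * (x * star v)) * v := by
          rw [mul_assoc v ((1 - z) * _), mul_assoc (1 - z), mul_assoc x, (Unitary.mem_iff.1 hv).1,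
            mul_one, hzc', mul_assoc]
      _ = (1 - z) * (v * star v) * y i * v := by
          rw [h2, ← mul_assoc v, ← hzc' v]; simp only [mul_assoc]
      _ = y i * v * (1 - z) := by
          rw [(Unitary.mem_iff.1 hv).2, mul_one, mul_assoc, hzc']
  have hvs := Unitary.mem_iff.1 hv
  have hus := Unitary.mem_iff.1 hu
  set w := u * z + v * (1 - z) with hw
  have hwx : w * x = y i * w := by
    rw [hw, add_mul, mul_assoc u, hzc, mul_assoc v, hzc', ← mul_assoc, ← mul_assoc, hux', hvx',
      mul_add, mul_assoc, mul_assoc]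
  have hws : star w = star u * z + star v * (1 - z) := by
    simp only [hw, star_add, star_mul, star_sub, star_one, hzs, hzc', ← hzc (star u)]
  have hmul (a b c d : M.toStarSubalgebra) :
      (a * z + b * (1 - z)) * (c * z + d * (1 - z)) = a * c * z + b * d * (1 - z) := by
    calc _ = a * (z * c) * z + a * (z * d) * (1 - z) + b * ((1 - z) * c) * z +
          b * ((1 - z) * d) * (1 - z) := by noncomm_ring
      _ = _ := by
        rw [hzc c, hzc d, hzc' c, hzc' d]
        simp [mul_assoc, hzz, h01, h10, h11]
  have hwu : star w * w = 1 ∧ w * star w = 1 := by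
    rw [hws, hw, hmul, hmul, hus.1, hus.2, hvs.1, hvs.2]
    simp
  refine ⟨star w, Unitary.star_mem (Unitary.mem_iff.2 hwu), ?_⟩
  rw [star_star, hwx, mul_assoc, hwu.2, mul_one]

end VonNeumannAlgebra

/-! ### Polar factorization and C⋆-extreme points -/

/-- Take v = x(s + ε)⁻¹: it is a contraction because s² ≤ (s + ε)², and vs - x = -εv. -/
theorem CStarAlgebra.exists_norm_mul_sub_le {A : Type*} [CStarAlgebra A] [PartialOrder A]
    [StarOrderedRing A] {x s : A} (hs : 0 ≤ s) (h : s * s = star x * x) {ε : ℝ}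
    (hε : 0 < ε) : ∃ v : A, ‖v‖ ≤ 1 ∧ ‖v * s - x‖ ≤ ε := by
  have hεA : 0 ≤ algebraMap ℝ A ε := by
    rw [Algebra.algebraMap_eq_smul_one]; exact smul_nonneg hε.le zero_le_one
  have hunit : IsUnit (s + algebraMap ℝ A ε) := by
    refine CStarAlgebra.isUnit_of_le (algebraMap ℝ A ε) (le_add_of_nonneg_left hs) ?_
    exact ⟨hεA, (IsUnit.mk0 ε hε.ne').map _⟩
  obtain ⟨b, hb⟩ := hunit
  have hbs : star (b : A) = b := by rw [hb]; exact (add_nonneg hs hεA).isSelfAdjoint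
  have hbsi : star (↑b⁻¹ : A) = ↑b⁻¹ := by
    have : star b = b := Units.ext hbs
    rw [← Units.coe_star_inv, this]
  have hv : ‖x * (↑b⁻¹ : A)‖ ≤ 1 := by
    rw [norm_le_one_iff_star_mul_self_le_one]
    have h1 : s * s ≤ b * b := by
      have : (b * b : A) = s * s + (2 * ε) • s + (ε * ε) • (1 : A) := by
        rw [hb, Algebra.algebraMap_eq_smul_one]
        simp only [mul_add, add_mul, smul_mul_assoc, mul_smul_comm, one_mul, mul_one]
        module
      rw [this, add_assoc]
      exact le_add_of_nonneg_right (add_nonneg (smul_nonneg (by positivity) hs)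
        (smul_nonneg (by positivity) zero_le_one))
    have h2 := star_left_conjugate_le_conjugate h1 (↑b⁻¹ : A)
    calc _ = star (↑b⁻¹ : A) * (s * s) * ↑b⁻¹ := by rw [h]; simp [mul_assoc]
      _ ≤ _ := h2
      _ = 1 := by rw [hbsi]; simp
  refine ⟨x * ↑b⁻¹, hv, ?_⟩
  have : x * ↑b⁻¹ * s - x = -(ε • (x * (↑b⁻¹ : A))) := by
    have h3 : s = b - ε • (1 : A) := by rw [hb, Algebra.algebraMap_eq_smul_one]; abel
    rw [h3, mul_sub, mul_assoc]
    simp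
  rw [this, norm_neg, norm_smul, Real.norm_of_nonneg hε.le]
  exact mul_le_of_le_one_right hε.le hv

namespace CStarAlgebra

variable {A : Type*} [CStarAlgebra A]

theorem exists_abs {x : A} : ∃ s : A, IsSelfAdjoint s ∧ s * s = star x * x ∧
    ∀ ε > 0, ∃ v : A, ‖v‖ ≤ 1 ∧ ‖v * s - x‖ ≤ ε := by
  let _ := CStarAlgebra.spectralOrder A
  have := CStarAlgebra.spectralOrderedRing A
  have h := CFC.sqrt_mul_sqrt_self (star x * x) (star_mul_self_nonneg x)
  exact ⟨_, (CFC.sqrt_nonneg _).isSelfAdjoint, h,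
    fun ε hε => exists_norm_mul_sub_le (CFC.sqrt_nonneg _) h hε⟩

/-- Here d*d ≤ 1 - v*v, and v preserves s*s, so (ds)*(ds) ≤ s*(1 - v*v)s = 0. This makes the
contractions v with vs = x a face of the ball when s = |x|. -/
theorem mul_eq_zero_of_norm_le {v d s : A} (h₁ : ‖v + d‖ ≤ 1) (h₂ : ‖v - d‖ ≤ 1)
    (h : star (v * s) * (v * s) = star s * s) : d * s = 0 := by
  let _ := CStarAlgebra.spectralOrder A
  have := CStarAlgebra.spectralOrderedRing A
  have h0 := star_left_conjugate_le_conjugate (star_mul_self_le_one_sub_of_norm_le h₁ h₂) s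
  have h1 : star s * (1 - star v * v) * s = 0 := by
    calc _ = star s * s - star (v * s) * (v * s) := by rw [star_mul]; noncomm_ring
      _ = 0 := by rw [h, sub_self]
  rw [h1] at h0
  refine CStarRing.star_mul_self_eq_zero_iff _ |>.1 (le_antisymm ?_ (star_mul_self_nonneg _))
  simpa [mul_assoc] using h0

theorem exists_unitary_eq_half_add_star {s : A} (hs : IsSelfAdjoint s) (h : ‖s‖ ≤ 1) :
    ∃ u ∈ unitary A, s = (1 / 2 : ℝ) • (u + star u) := by
  let _ := CStarAlgebra.spectralOrder A
  have := CStarAlgebra.spectralOrderedRing A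
  refine ⟨_, hs.self_add_I_smul_cfcSqrt_sub_sq_mem_unitary s h, ?_⟩
  have h2 : star (CFC.sqrt (1 - s ^ 2)) = CFC.sqrt (1 - s ^ 2) :=
    (CFC.sqrt_nonneg (1 - s ^ 2)).isSelfAdjoint.star_eq
  rw [star_add, star_smul, hs.star_eq, h2,
    Complex.star_def, Complex.conj_I, neg_smul]
  module

theorem unitary_mul_mul_mem_extremePoints {u v a : A} (hu : u ∈ unitary A) (hv : v ∈ unitary A)
    (ha : a ∈ Set.extremePoints ℝ (closedBall (0 : A) 1)) :
    u * a * v ∈ Set.extremePoints ℝ (closedBall (0 : A) 1) := by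
  have hnorm (b : A) : ‖u * b * v‖ = ‖b‖ := by
    rw [CStarRing.norm_mul_mem_unitary _ hv, CStarRing.norm_mem_unitary_mul _ hu]
  rw [mem_extremePoints_closedBall_iff] at ha ⊢
  refine ⟨by rw [hnorm]; exact ha.1, fun d h₁ h₂ => ?_⟩
  obtain ⟨d, rfl⟩ : ∃ c, u * c * v = d := by
    refine ⟨star u * d * star v, ?_⟩
    rw [mul_assoc, mul_assoc, (Unitary.mem_iff.1 hv).1, mul_one, ← mul_assoc,
      (Unitary.mem_iff.1 hu).2, one_mul]
  rw [← add_mul, ← mul_add, hnorm] at h₁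
  rw [← sub_mul, ← mul_sub, hnorm] at h₂
  rw [ha.2 d h₁ h₂, mul_zero, zero_mul]

end CStarAlgebra

theorem IsCStarExtremePoint.mem_extremePoints_of_eq_mul {A : Type*} [CStarAlgebra A] {x v s : A}
    (hx : IsCStarExtremePoint x) (hv : v ∈ Set.extremePoints ℝ (closedBall (0 : A) 1))
    (hs : IsSelfAdjoint s) (hs1 : ‖s‖ ≤ 1) (hvs : v * s = x) :
    x ∈ Set.extremePoints ℝ (closedBall (0 : A) 1) := by
  obtain ⟨w, hw, rfl⟩ := CStarAlgebra.exists_unitary_eq_half_add_star hs hs1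
  have hext {w : A} (hw : w ∈ unitary A) :
      v * w ∈ Set.extremePoints ℝ (closedBall (0 : A) 1) := by
    simpa using CStarAlgebra.unitary_mul_mul_mem_extremePoints (one_mem _) hw hv
  have hsq : (√2 : ℝ)⁻¹ * (√2)⁻¹ = 1 / 2 := by rw [← mul_inv]; simp
  -- Both coefficients are 1/√2, so the combination is the ordinary mean of vw and vw*.
  obtain ⟨u, hu, hvw⟩ := hx.2 2 ![v * w, v * star w] (fun _ => (√2)⁻¹ • 1)
    (by
      intro i
      fin_cases i
      · exact (hext hw).1
      · exact (hext (Unitary.star_mem hw)).1)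
    ⟨⟨by
        simp only [star_smul, star_one, star_trivial, smul_mul_smul_comm, mul_one, hsq,
          Fin.sum_univ_two]
        module,
      by
        simp only [star_smul, star_one, star_trivial, smul_mul_assoc, mul_smul_comm, smul_smul,
          one_mul, mul_one, hsq, Fin.sum_univ_two, ← hvs, mul_add, smul_add]
        simp⟩,
      fun _ => by
        rw [← Algebra.algebraMap_eq_smul_one]
        exact (IsUnit.mk0 _ (by positivity)).map (algebraMap ℝ A)⟩ 0
  have : x = u * (v * w) * star u := by
    rw [show v * w = star u * x * u from hvw, mul_assoc, mul_assoc, (Unitary.mem_iff.1 hu).2,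
      mul_one, ← mul_assoc, (Unitary.mem_iff.1 hu).2, one_mul]
  rw [this]
  exact CStarAlgebra.unitary_mul_mul_mem_extremePoints hu (Unitary.star_mem hu) (hext hw)

/-! ### Weak operator compactness and an extreme polar factor -/

namespace VonNeumannAlgebra

variable {H : Type*} [NormedAddCommGroup H] [InnerProductSpace ℂ H] [CompleteSpace H]
  (M : VonNeumannAlgebra H)

/-- The sesquilinear form of an operator, as a real linear map into the space of functions of two
variables; the product topology there induces the weak operator topology. -/
noncomputable def formMap : M.toStarSubalgebra →ₗ[ℝ] H → H → ℂ where
  toFun a v w := inner ℂ ((a : H →L[ℂ] H) v) w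
  map_add' a b := by ext v w; exact inner_add_left _ _ _
  map_smul' r a := by
    ext v w
    exact (inner_smul_left_eq_smul _ _ r)

@[simp]
theorem formMap_apply (a : M.toStarSubalgebra) (v w : H) :
    M.formMap a v w = inner ℂ ((a : H →L[ℂ] H) v) w := rfl

theorem formMap_injective : Function.Injective M.formMap := fun _ _ h =>
  Subtype.ext (ContinuousLinearMap.ext fun v => ext_inner_right ℂ fun w =>
    congrFun (congrFun h v) w)

theorem continuous_formMap : Continuous M.formMap :=
  continuous_pi fun v => continuous_pi fun _ =>
    Continuous.inner (𝕜 := ℂ)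
      ((ContinuousLinearMap.apply ℂ H v).continuous.comp continuous_subtype_val) continuous_const

theorem isCompact_formMap_image_closedBall :
    IsCompact (M.formMap '' closedBall (0 : M.toStarSubalgebra) 1) := by
  have hcpt : IsCompact (Set.univ.pi fun v : H => Set.univ.pi fun w : H =>
      closedBall (0 : ℂ) (‖v‖ * ‖w‖)) :=
    isCompact_univ_pi fun v => isCompact_univ_pi fun w => isCompact_closedBall _ _
  have hsub : M.formMap '' closedBall (0 : M.toStarSubalgebra) 1 ⊆
      Set.univ.pi fun v : H => Set.univ.pi fun w : H => closedBall (0 : ℂ) (‖v‖ * ‖w‖) := by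
    rintro _ ⟨a, ha, rfl⟩ v - w -
    rw [mem_closedBall_zero_iff] at ha ⊢
    refine (norm_inner_le_norm _ _).trans ?_
    gcongr
    exact ((a : H →L[ℂ] H).le_opNorm v).trans (mul_le_of_le_one_left (norm_nonneg _) ha)
  refine hcpt.of_isClosed_subset ?_ hsub
  -- Every condition involves finitely many evaluations of B, hence is closed; the last one, over
  -- the commutant, places the represented operator in M.
  have heq : M.formMap '' closedBall (0 : M.toStarSubalgebra) 1 =
      {B | (∀ v w, ‖B v w‖ ≤ ‖v‖ * ‖w‖) ∧ (∀ v v' w, B (v + v') w = B v w + B v' w) ∧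
        (∀ (c : ℂ) v w, B (c • v) w = star c • B v w) ∧
        (∀ v w w', B v (w + w') = B v w + B v w') ∧ (∀ (c : ℂ) v w, B v (c • w) = c • B v w) ∧
        ∀ b ∈ M.commutant, ∀ v w, B (b v) w = B v (star b w)} := by
    ext B
    constructor
    · rintro hB
      have hb := hsub hB
      obtain ⟨a, ha, rfl⟩ := hB
      refine ⟨fun v w => by simpa using hb v trivial w trivial, ?_, ?_, ?_, ?_, ?_⟩
      · exact fun _ _ _ => by simp only [formMap_apply, map_add, inner_add_left]
      · exact fun _ _ _ => by
          simp only [formMap_apply, map_smul, inner_smul_left, smul_eq_mul, starRingEnd_apply]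
      · exact fun _ _ _ => inner_add_right _ _ _
      · exact fun _ _ _ => inner_smul_right _ _ _
      · intro b hb v w
        have h1 : (a : H →L[ℂ] H) (b v) = b ((a : H →L[ℂ] H) v) :=
          DFunLike.congr_fun (mem_commutant_iff.1 hb _ a.2) v
        rw [formMap_apply, formMap_apply, h1]
        exact (ContinuousLinearMap.adjoint_inner_right b _ _).symm
    · rintro ⟨hb, h1, h2, h3, h4, h5⟩
      set T : H →L⋆[ℂ] H →L[ℂ] ℂ := LinearMap.mkContinuous₂
        (LinearMap.mk₂'ₛₗ (starRingEnd ℂ) (RingHom.id ℂ) B h1 h2 h3 h4) 1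
        (fun v w => by simpa using hb v w)
      set a := InnerProductSpace.continuousLinearMapOfBilin T
      have ha v w : inner ℂ (a v) w = B v w :=
        InnerProductSpace.continuousLinearMapOfBilin_apply T v w
      have haM : a ∈ M := by
        refine M.mem_iff_forall_commutant.2 fun b hb => ContinuousLinearMap.ext fun v =>
          ext_inner_right ℂ fun w => ?_
        change inner ℂ (b (a v)) w = inner ℂ (a (b v)) w
        rw [ha, h5 b hb, ← ha]
        exact (ContinuousLinearMap.adjoint_inner_right b _ _).symm
      refine ⟨⟨a, haM⟩, ?_, by ext v w; exact ha v w⟩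
      rw [mem_closedBall_zero_iff]
      refine ContinuousLinearMap.opNorm_le_bound a zero_le_one fun v => ?_
      have h := hb v (a v)
      rw [← ha, inner_self_eq_norm_sq_to_K] at h
      rw [one_mul]
      by_contra! hlt
      have hpos : 0 < ‖a v‖ := (norm_nonneg v).trans_lt hlt
      simp at h
      nlinarith
  rw [heq]
  have hc (v w : H) : Continuous fun B : H → H → ℂ => B v w := by fun_prop
  simp only [Set.ofPred_and, Set.ofPred_forall]
  refine .inter ?_ (.inter ?_ (.inter ?_ (.inter ?_ (.inter ?_ ?_)))) <;>
    repeat' refine isClosed_iInter fun _ => ?_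
  · exact isClosed_le (hc _ _).norm continuous_const
  · exact isClosed_eq (hc _ _) ((hc _ _).add (hc _ _))
  · exact isClosed_eq (hc _ _) (by fun_prop)
  · exact isClosed_eq (hc _ _) ((hc _ _).add (hc _ _))
  · exact isClosed_eq (hc _ _) (by fun_prop)
  · exact isClosed_eq (hc _ _) (hc _ _)

/-- An element `x` of a von Neumann algebra is the product of an extreme point of
the ball and the absolute value of `x`. -/
theorem exists_mem_extremePoints_mul_eq (x : M.toStarSubalgebra) :
    ∃ s, IsSelfAdjoint s ∧ s * s = star x * x ∧
      ∃ v ∈ Set.extremePoints ℝ (closedBall (0 : M.toStarSubalgebra) 1), v * s = x := by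
  obtain ⟨s, hs, h, happ⟩ := CStarAlgebra.exists_abs (x := x)
  refine ⟨s, hs, h, ?_⟩
  set K := M.formMap '' closedBall (0 : M.toStarSubalgebra) 1
  have hK : IsCompact K := M.isCompact_formMap_image_closedBall
  have hc (v w : H) : Continuous fun B : H → H → ℂ => B v w := by fun_prop
  set T : (H → H → ℂ) → H → H → ℂ := fun B v => B ((s : H →L[ℂ] H) v)
  have hT : Continuous T := continuous_pi fun v => continuous_apply _
  have hTform (v : M.toStarSubalgebra) : T (M.formMap v) = M.formMap (v * s) := rfl
  -- The image of a compact set is closed, so the approximate factorizations vs ≈ x yield an exact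
  -- one.
  have hne : M.formMap x ∈ T '' K := by
    rw [← (hK.image hT).isClosed.closure_eq]
    have hx' : x ∈ closure ((· * s) '' closedBall (0 : M.toStarSubalgebra) 1) := by
      refine Metric.mem_closure_iff.2 fun ε hε => ?_
      obtain ⟨v, hv, hvx⟩ := happ _ (half_pos hε)
      refine ⟨v * s, ⟨v, mem_closedBall_zero_iff.2 hv, rfl⟩, ?_⟩
      rw [dist_comm, dist_eq_norm]
      linarith
    refine map_mem_closure M.continuous_formMap hx' ?_
    rintro _ ⟨v, hv, rfl⟩
    exact ⟨M.formMap v, ⟨v, hv, rfl⟩, hTform v⟩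
  have hF : IsCompact (K ∩ T ⁻¹' {M.formMap x}) :=
    hK.inter_right (isClosed_singleton.preimage hT)
  obtain ⟨B, hB, hBx⟩ := hne
  obtain ⟨B, hB⟩ := hF.extremePoints_nonempty ⟨B, hB, hBx⟩
  obtain ⟨⟨⟨v, hv, rfl⟩, hvx⟩, hB⟩ := mem_extremePoints_iff_left.1 hB
  have hvs : v * s = x := M.formMap_injective ((hTform v).symm.trans hvx)
  refine ⟨v, mem_extremePoints_closedBall_iff.2
    ⟨mem_closedBall_zero_iff.1 hv, fun d h₁ h₂ => ?_⟩, hvs⟩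
  -- Face property: v ± d also solve the equation, so extremality among solutions gives extremality
  -- in the whole ball.
  have hds : d * s = 0 :=
    CStarAlgebra.mul_eq_zero_of_norm_le h₁ h₂ (by rw [hvs, hs.star_eq, h])
  have hmem {a : M.toStarSubalgebra} (ha : ‖a‖ ≤ 1) (has : a * s = x) :
      M.formMap a ∈ K ∩ T ⁻¹' {M.formMap x} :=
    ⟨⟨a, mem_closedBall_zero_iff.2 ha, rfl⟩, by rw [← has]; exact hTform a⟩
  have := hB _ (hmem h₁ (by rw [add_mul, hds, hvs, add_zero])) _
    (hmem h₂ (by rw [sub_mul, hds, hvs, sub_zero]))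
    ⟨1 / 2, 1 / 2, by norm_num, by norm_num, by norm_num, by
      rw [← map_smul, ← map_smul, ← map_add]; congr 1; module⟩
  simpa using M.formMap_injective this

variable {M}

theorem mem_extremePoints_of_isCStarExtremePoint {x : M.toStarSubalgebra}
    (hx : IsCStarExtremePoint x) :
    x ∈ Set.extremePoints ℝ (closedBall (0 : M.toStarSubalgebra) 1) := by
  obtain ⟨s, hs, hss, v, hv, hvs⟩ := M.exists_mem_extremePoints_mul_eq x
  refine hx.mem_extremePoints_of_eq_mul hv hs ?_ hvs
  have h1 := mem_closedBall_zero_iff.1 hx.1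
  have h2 : ‖s‖ * ‖s‖ = ‖x‖ * ‖x‖ := by
    rw [← CStarRing.norm_star_mul_self, ← CStarRing.norm_star_mul_self (x := x), hs.star_eq, hss]
  nlinarith [norm_nonneg s, norm_nonneg x]

end VonNeumannAlgebra

theorem theoremB :
    (∀ (H : Type*) [NormedAddCommGroup H] [InnerProductSpace ℂ H] [CompleteSpace H]
      (M : VonNeumannAlgebra H) (x : M.toStarSubalgebra),
      x ∈ closedBall (0 : M.toStarSubalgebra) 1 →
      List.TFAE [
        IsCStarExtremePoint x,
        x ∈ Set.extremePoints ℝ (closedBall (0 : M.toStarSubalgebra) 1),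
        IsStronglyExtremePoint x]) ∧
    (∀ (A : Type*) [CStarAlgebra A] (x : A),
      x ∈ Set.extremePoints ℝ (closedBall (0 : A) 1) → IsStronglyExtremePoint x) := by
  refine ⟨fun H _ _ _ M x _ => ?_, fun A _ x hx =>
    CStarAlgebra.isStronglyExtremePoint_of_mem_extremePoints hx⟩
  tfae_have 1 → 2 := VonNeumannAlgebra.mem_extremePoints_of_isCStarExtremePoint
  tfae_have 2 → 1 := VonNeumannAlgebra.isCStarExtremePoint_of_mem_extremePoints
  tfae_have 2 → 3 := CStarAlgebra.isStronglyExtremePoint_of_mem_extremePoints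
  tfae_have 3 → 2 := IsStronglyExtremePoint.mem_extremePoints
  tfae_finish
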